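/- Let $N\ge 2$ be an integer. For $\theta\in(0,\pi/4]$ let $\rho_N^{\theta}=|GHZ_N^{\theta}\rangle\langle GHZ_N^{\theta}|$ be the $N$-qubit pure state with $$|GHZ_N^{\theta}\rangle=\cos\theta\,|0\rangle^{\otimes N}+\sin\theta\,|1\rangle^{\otimes N}.$$ An operation by local operations and shared randomness (LOSR) on $N$ qubits, one held by each of $N$ parties, is a map of the form $$T=\sum_{\lambda}p(\lambda)\,\mathcal E^{(1)}_{\lambda}\otimes\cdots\otimes\mathcal E^{(N)}_{\lambda},$$ where $p$ is the probability distribution of a classical variable $\lambda$ shared by all parties and every $\mathcal E^{(i)}_{\lambda}$ is a completely positive trace-preserving map on the matrices $M_2(\mathbb C)$ of the $i$-th qubit (for a non-discrete distribution of $\lambda$ the sum is replaced by an integral, the product of channels depending measurably on $\lambda$). Then for all $\theta,\phi\in(0,\pi/4]$ with $\theta\neq\phi$ there is no LOSR operation $T$ with $T(\rho_N^{\theta})=\rho_N^{\phi}$. -/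

import Mathlib

open MeasureTheory
open scoped CStarAlgebra MatrixOrder Matrix.Norms.L2Operator

/-- A quantum channel from a system with Hilbert space `ℂⁿ` to one with Hilbert space `ℂᵐ`:
a completely positive trace-preserving linear map between the full matrix algebras. -/
structure QuantumChannel (n m : Type*) [Fintype n] [DecidableEq n] [Fintype m] [DecidableEq m]
    extends Matrix n n ℂ →CP Matrix m m ℂ where
  trace_map' : ∀ X : Matrix n n ℂ, (toFun X).trace = X.trace

/-- The tensor product `⨂ᵢ Eᵢ` of linear maps on matrix algebras, one for each party `i : ι`.
The joint space `(ℂⁿ)^{⊗ι}` has the basis `ι → n`, and the map is given by linear extension of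
`⨂ᵢ |aᵢ⟩⟨bᵢ| ↦ ⨂ᵢ Eᵢ(|aᵢ⟩⟨bᵢ|)`. -/
noncomputable def tensorMap {ι n m : Type*} [Fintype ι] [DecidableEq ι] [Fintype n]
    [DecidableEq n] (E : ι → (Matrix n n ℂ →ₗ[ℂ] Matrix m m ℂ))
    (X : Matrix (ι → n) (ι → n) ℂ) : Matrix (ι → m) (ι → m) ℂ :=
  Matrix.of fun a' b' =>
    ∑ a : ι → n, ∑ b : ι → n,
      X a b * ∏ i, E i (Matrix.single (a i) (b i) 1) (a' i) (b' i)

/-- On product operators, `tensorMap` acts factor by factor. -/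
theorem tensorMap_product {ι n m : Type*} [Fintype ι] [DecidableEq ι] [Fintype n]
    [DecidableEq n] (E : ι → (Matrix n n ℂ →ₗ[ℂ] Matrix m m ℂ)) (X : ι → Matrix n n ℂ) :
    tensorMap E (Matrix.of fun a b => ∏ i, X i (a i) (b i)) =
      Matrix.of fun a' b' => ∏ i, E i (X i) (a' i) (b' i) := by
  ext a' b'
  have h : ∀ i, E i (X i) (a' i) (b' i) =
      ∑ s : n, ∑ t : n, X i s t * E i (Matrix.single s t 1) (a' i) (b' i) := by
    intro i
    conv_lhs => rw [Matrix.matrix_eq_sum_single (X i)]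
    simp only [map_sum, Matrix.sum_apply]
    refine Finset.sum_congr rfl fun s _ => Finset.sum_congr rfl fun t _ => ?_
    have : Matrix.single s t (X i s t) = X i s t • Matrix.single s t (1 : ℂ) := by
      simp [Matrix.smul_single]
    rw [this, map_smul, Matrix.smul_apply, smul_eq_mul]
  simp only [tensorMap, Matrix.of_apply]
  rw [Finset.prod_congr rfl fun i _ => h i, Fintype.prod_sum]
  refine Finset.sum_congr rfl fun a _ => ?_
  rw [Fintype.prod_sum]
  refine Finset.sum_congr rfl fun b _ => ?_
  rw [Finset.prod_mul_distrib]

/-- An LOSR operation on systems shared by the parties `i : ι`: the value `l` of a classical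
random variable (with an arbitrary probability distribution `μ`) is distributed to all parties,
and party `i` applies to its system a local channel `E l i` depending on `l`; the operation is
the average `T = ∫ ⨂ᵢ E l i dμ(l)` (entrywise), for instance a finite or countable mixture
`∑_l p(l) ⨂ᵢ E l i`. The entries of a product of channels are bounded uniformly in `l`, so
the integrability clause only says that the joint operation depends measurably on `l`. -/
def IsLOSROperation {ι n m : Type*} [Fintype ι] [DecidableEq ι] [Fintype n] [DecidableEq n]
    [Fintype m] [DecidableEq m]
    (T : Matrix (ι → n) (ι → n) ℂ → Matrix (ι → m) (ι → m) ℂ) : Prop :=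
  ∃ (Λ : Type) (_ : MeasurableSpace Λ) (μ : Measure Λ) (_ : IsProbabilityMeasure μ)
    (E : Λ → ι → QuantumChannel n m),
    (∀ X a b, Integrable (fun l => tensorMap (fun i => (E l i).toLinearMap) X a b) μ) ∧
    ∀ X a b, T X a b = ∫ l, tensorMap (fun i => (E l i).toLinearMap) X a b ∂μ

/-- `ρ` can be converted into `σ` by an LOSR operation. -/
def LOSRConvertible {ι n m : Type*} [Fintype ι] [DecidableEq ι] [Fintype n] [DecidableEq n]
    [Fintype m] [DecidableEq m]
    (ρ : Matrix (ι → n) (ι → n) ℂ) (σ : Matrix (ι → m) (ι → m) ℂ) : Prop :=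
  ∃ T : Matrix (ι → n) (ι → n) ℂ → Matrix (ι → m) (ι → m) ℂ, IsLOSROperation T ∧ T ρ = σ

/-- The vector `cos θ |0…0⟩ + sin θ |1…1⟩` of `N` qubits, in the computational basis. -/
noncomputable def ghzVector (N : ℕ) (θ : ℝ) : (Fin N → Fin 2) → ℂ :=
  (Real.cos θ : ℂ) • Pi.single (fun _ => 0) 1 + (Real.sin θ : ℂ) • Pi.single (fun _ => 1) 1

/-- The pure state `|GHZ⟩⟨GHZ|` belonging to `ghzVector N θ`. -/
noncomputable def ghzState (N : ℕ) (θ : ℝ) : Matrix (Fin N → Fin 2) (Fin N → Fin 2) ℂ :=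
  Matrix.vecMulVec (ghzVector N θ) (star (ghzVector N θ))

/-!
A pure state is an extreme point of the set of states, so if a mixture of products of local channels
produces one, then some product in the mixture already does. Each Kraus operator of this product,
itself a tensor product of local Kraus operators, sends the initial vector to a multiple of the
final one. Fixing the Kraus operators of all parties but one, and using that the final reduced state
of that party is invertible, one finds that its Kraus operators are proportional to each other.
Its channel therefore acts as a unitary, and the spectrum of its reduced state is unchanged. For
the vectors `∑ₛ aₛ |s…s⟩` with at least two parties this spectrum is `{|aₛ|²}`, and
`{cos² θ, sin² θ}` determines `θ` in `(0, π/4]`.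
-/

open Matrix
open scoped ComplexOrder

section Kraus

variable {n m κ : Type*} [Fintype n]

/-- The completely positive map `X ↦ ∑ₖ Kₖ X Kₖ†` with Kraus operators `K k`. -/
noncomputable def krausMap [Fintype κ] (K : κ → Matrix m n ℂ) :
    Matrix n n ℂ →ₗ[ℂ] Matrix m m ℂ where
  toFun X := ∑ k, K k * X * (K k)ᴴ
  map_add' X Y := by simp only [Matrix.mul_add, Matrix.add_mul, Finset.sum_add_distrib]
  map_smul' z X := by
    simp only [Matrix.mul_smul, Matrix.smul_mul, Finset.smul_sum, RingHom.id_apply]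

theorem krausMap_apply [Fintype κ] (K : κ → Matrix m n ℂ) (X : Matrix n n ℂ) :
    krausMap K X = ∑ k, K k * X * (K k)ᴴ := rfl

theorem krausMap_single_apply [Fintype κ] [DecidableEq n] (K : κ → Matrix m n ℂ) (a b : n)
    (x y : m) : krausMap K (single a b 1) x y = ∑ k, K k x a * star (K k y b) := by
  simp only [krausMap_apply, Matrix.sum_apply, single_eq_single_vecMulVec_single, mul_vecMulVec,
    vecMulVec_mul, vecMulVec_apply, mulVec_single_one, single_one_vecMul, col_apply, row_apply,
    conjTranspose_apply]

theorem posSemidef_krausMap [Fintype κ] [Finite m] (K : κ → Matrix m n ℂ) {X : Matrix n n ℂ}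
    (hX : X.PosSemidef) : (krausMap K X).PosSemidef :=
  posSemidef_sum _ fun k _ => hX.mul_mul_conjTranspose_same (K k)

theorem trace_krausMap [Fintype κ] [Fintype m] (K : κ → Matrix m n ℂ) (X : Matrix n n ℂ) :
    (krausMap K X).trace = ((∑ k, (K k)ᴴ * K k) * X).trace := by
  simp only [krausMap_apply, trace_sum, Finset.sum_mul, Matrix.mul_assoc]
  refine Finset.sum_congr rfl fun k _ => ?_
  rw [← Matrix.mul_assoc, Matrix.trace_mul_comm]

variable [DecidableEq n]

/-- This is the Choi matrix of the identity map, so that applying a completely positive map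
blockwise yields the Choi matrix of that map. It equals `V† V` for `V = ∑ₐ |n₀⟩⟨a| ⊗ |n₀⟩⟨a|`, with
`n₀` any fixed index. -/
theorem cstarMatrix_single_nonneg :
    0 ≤ CStarMatrix.ofMatrix fun a b : n => single a b (1 : ℂ) := by
  rcases isEmpty_or_nonempty n with hn | ⟨⟨n₀⟩⟩
  · exact (Subsingleton.elim _ _).le
  let V : CStarMatrix n n (Matrix n n ℂ) :=
    CStarMatrix.ofMatrix fun k a => if k = n₀ then single n₀ a 1 else 0
  have hV : (CStarMatrix.ofMatrix fun a b : n => single a b (1 : ℂ)) = star V * V := by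
    ext1 a b
    have hVe (k c : n) : V k c = if k = n₀ then single n₀ c 1 else 0 := rfl
    simp only [CStarMatrix.mul_apply, CStarMatrix.star_apply, hVe, mul_ite, mul_zero,
      Finset.sum_ite_eq', Finset.mem_univ, if_true, star_eq_conjTranspose, conjTranspose_single,
      star_one, single_mul_single_same, one_mul]
    rfl
  exact hV ▸ star_mul_self_nonneg V

-- Instance search does not find the functional calculus of `CStarMatrix`, hence this detour through
-- a type whose only structure is that of a C⋆-algebra.
theorem exists_eq_star_mul_self_of_nonneg {A : Type*} [NonUnitalCStarAlgebra A] [PartialOrder A]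
    [StarOrderedRing A] {a : A} (ha : 0 ≤ a) : ∃ b, a = star b * b :=
  CStarAlgebra.nonneg_iff_eq_star_mul_self.mp ha

theorem exists_eq_krausMap_of_completelyPositive [Fintype m] [DecidableEq m]
    (E : Matrix n n ℂ →CP Matrix m m ℂ) :
    ∃ K : n × m → Matrix m n ℂ, E.toLinearMap = krausMap K := by
  obtain ⟨M, hM⟩ := exists_eq_star_mul_self_of_nonneg
    (E.map_cstarMatrix_nonneg _ cstarMatrix_single_nonneg)
  refine ⟨fun k => of fun x a => star (M k.1 a k.2 x), ?_⟩
  refine Matrix.ext_linearMap ℂ fun a b => LinearMap.ext_ring (Matrix.ext fun x y => ?_)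
  have hab : E.toLinearMap (single a b 1) = (star M * M) a b := by rw [← hM]; rfl
  simp only [LinearMap.comp_apply, singleLinearMap_apply]
  rw [hab, krausMap_single_apply, CStarMatrix.mul_apply, Matrix.sum_apply, Fintype.sum_prod_type]
  simp only [CStarMatrix.star_apply, star_apply, mul_apply, of_apply, star_star]

theorem QuantumChannel.exists_eq_krausMap [Fintype m] [DecidableEq m] (E : QuantumChannel n m) :
    ∃ K : n × m → Matrix m n ℂ, E.toLinearMap = krausMap K ∧ ∑ k, (K k)ᴴ * K k = 1 := by
  obtain ⟨K, hK⟩ := exists_eq_krausMap_of_completelyPositive E.toCompletelyPositiveMap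
  refine ⟨K, hK, ext_iff_trace_mul_right.mpr fun X => ?_⟩
  rw [← trace_krausMap, ← hK, Matrix.one_mul]
  exact E.trace_map' X

end Kraus

section PiKronecker

variable {ι l m n R : Type*} [Fintype ι] [CommSemiring R]

/-- The Kronecker product `⨂ᵢ Aᵢ` of a family of matrices. -/
def piKronecker (A : ι → Matrix m n R) : Matrix (ι → m) (ι → n) R :=
  of fun x a => ∏ i, A i (x i) (a i)

theorem piKronecker_one [DecidableEq n] :
    piKronecker (fun _ : ι => (1 : Matrix n n R)) = 1 := by
  ext a b
  simp only [piKronecker, of_apply, one_apply, Finset.prod_ite_zero, Finset.prod_const_one,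
    Finset.mem_univ, forall_const, funext_iff]

theorem conjTranspose_piKronecker [StarRing R] (A : ι → Matrix m n R) :
    (piKronecker A)ᴴ = piKronecker fun i => (A i)ᴴ := by
  ext a x
  simp only [piKronecker, of_apply, conjTranspose_apply, star_prod]

theorem piKronecker_mul [DecidableEq ι] [Fintype m] (A : ι → Matrix l m R)
    (B : ι → Matrix m n R) :
    piKronecker A * piKronecker B = piKronecker fun i => A i * B i := by
  ext x a
  simp only [piKronecker, of_apply, mul_apply, Fintype.prod_sum, Finset.prod_mul_distrib]

theorem sum_piKronecker [DecidableEq ι] {κ : Type*} [Fintype κ] (A : ι → κ → Matrix m n R) :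
    ∑ f : ι → κ, piKronecker (fun i => A i (f i)) = piKronecker fun i => ∑ k, A i k := by
  ext x a
  simp only [piKronecker, of_apply, Matrix.sum_apply, Fintype.prod_sum]

theorem sum_conjTranspose_mul_self_piKronecker [StarRing R] [DecidableEq ι] {κ : Type*}
    [Fintype κ] [Fintype m] [DecidableEq n] {K : ι → κ → Matrix m n R}
    (hK : ∀ i, ∑ k, (K i k)ᴴ * K i k = 1) :
    ∑ f : ι → κ, (piKronecker fun i => K i (f i))ᴴ * piKronecker (fun i => K i (f i)) = 1 := by
  simp only [conjTranspose_piKronecker, piKronecker_mul]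
  rw [sum_piKronecker fun i k => (K i k)ᴴ * K i k]
  simp only [hK, piKronecker_one]

theorem tensorMap_krausMap [DecidableEq ι] {κ : Type*} [Fintype κ] [Fintype n] [DecidableEq n]
    (K : ι → κ → Matrix m n ℂ) (X : Matrix (ι → n) (ι → n) ℂ) :
    tensorMap (fun i => krausMap (K i)) X =
      krausMap (fun f : ι → κ => piKronecker fun i => K i (f i)) X := by
  ext x y
  have hX : X = ∑ a, ∑ b, X a b • single a b (1 : ℂ) := by
    simpa only [smul_single, smul_eq_mul, mul_one] using matrix_eq_sum_single X
  conv_rhs => rw [hX]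
  simp only [tensorMap, of_apply, map_sum, map_smul, Matrix.sum_apply, Matrix.smul_apply,
    smul_eq_mul, krausMap_single_apply, Fintype.prod_sum, piKronecker, star_prod,
    Finset.prod_mul_distrib]

theorem exists_tensorMap_eq_krausMap [DecidableEq ι] [Fintype n] [DecidableEq n] [Fintype m]
    [DecidableEq m] (E : ι → QuantumChannel n m) :
    ∃ K : ι → n × m → Matrix m n ℂ, (∀ i, ∑ k, (K i k)ᴴ * K i k = 1) ∧
      tensorMap (fun i => (E i).toLinearMap) =
        krausMap fun f : ι → n × m => piKronecker fun i => K i (f i) := by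
  choose K hEK hK using fun i => (E i).exists_eq_krausMap
  refine ⟨K, hK, funext fun X => ?_⟩
  simp only [hEK, tensorMap_krausMap]

end PiKronecker

section PureState

variable {n m κ : Type*}

/-- The projector `|ψ⟩⟨ψ|` onto a vector, which is not required to be a unit vector. -/
def pureState (ψ : n → ℂ) : Matrix n n ℂ :=
  vecMulVec ψ (star ψ)

theorem posSemidef_pureState [Finite n] (ψ : n → ℂ) : (pureState ψ).PosSemidef :=
  posSemidef_vecMulVec_self_star ψ

theorem pureState_smul (c : ℂ) (ψ : n → ℂ) :
    pureState (c • ψ) = (‖c‖ ^ 2 : ℂ) • pureState ψ := by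
  rw [pureState, pureState, star_smul, smul_vecMulVec, vecMulVec_smul, smul_smul, Complex.star_def,
    Complex.mul_conj']

variable [Fintype n]

theorem mul_pureState_mul_conjTranspose (A : Matrix m n ℂ) (ψ : n → ℂ) :
    A * pureState ψ * Aᴴ = pureState (A *ᵥ ψ) := by
  rw [pureState, pureState, mul_vecMulVec, vecMulVec_mul, star_mulVec]

theorem krausMap_pureState [Fintype κ] (K : κ → Matrix m n ℂ) (ψ : n → ℂ) :
    krausMap K (pureState ψ) = ∑ k, pureState (K k *ᵥ ψ) := by
  simp only [krausMap_apply, mul_pureState_mul_conjTranspose]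

theorem trace_pureState_eq_zero_iff {ψ : n → ℂ} : (pureState ψ).trace = 0 ↔ ψ = 0 := by
  rw [pureState, trace_vecMulVec, dotProduct_self_star_eq_zero]

variable [DecidableEq n]

/-- The orthogonal projection onto the complement of the line spanned by `χ`; for `χ = 0` it is the
identity. -/
noncomputable def complementProjection (χ : n → ℂ) : Matrix n n ℂ :=
  1 - (star χ ⬝ᵥ χ)⁻¹ • pureState χ

theorem complementProjection_mulVec (χ v : n → ℂ) :
    complementProjection χ *ᵥ v = v - ((star χ ⬝ᵥ χ)⁻¹ * (star χ ⬝ᵥ v)) • χ := by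
  rw [complementProjection, sub_mulVec, one_mulVec, smul_mulVec, pureState, vecMulVec_mulVec,
    op_smul_eq_smul, smul_smul]

theorem complementProjection_mulVec_self (χ : n → ℂ) : complementProjection χ *ᵥ χ = 0 := by
  rcases eq_or_ne χ 0 with rfl | hχ
  · rw [mulVec_zero]
  · rw [complementProjection_mulVec, inv_mul_cancel₀ (dotProduct_star_self_eq_zero.not.mpr hχ),
      one_smul, sub_self]

theorem isHermitian_complementProjection (χ : n → ℂ) : (complementProjection χ).IsHermitian := by
  have hr : IsSelfAdjoint (star χ ⬝ᵥ χ)⁻¹ :=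
    (dotProduct_star_self_nonneg χ).isSelfAdjoint.inv₀
  exact isHermitian_one.sub ((posSemidef_pureState χ).isHermitian.smul hr)

theorem complementProjection_mul_self (χ : n → ℂ) :
    complementProjection χ * complementProjection χ = complementProjection χ := by
  nth_rw 2 [complementProjection]
  rw [Matrix.mul_sub, Matrix.mul_one, Matrix.mul_smul, pureState, mul_vecMulVec,
    complementProjection_mulVec_self, zero_vecMulVec, smul_zero, sub_zero]

theorem complementProjection_mul_pureState (χ : n → ℂ) :
    complementProjection χ * pureState χ = 0 := by
  rw [pureState, mul_vecMulVec, complementProjection_mulVec_self, zero_vecMulVec]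

theorem trace_complementProjection_mul_pureState (χ v : n → ℂ) :
    (complementProjection χ * pureState v).trace =
      (pureState (complementProjection χ *ᵥ v)).trace := by
  rw [← mul_pureState_mul_conjTranspose, (isHermitian_complementProjection χ).eq, trace_mul_cycle,
    complementProjection_mul_self]

/-- Pure states are extreme: the only mixtures without a component orthogonal to `χ` are mixtures
of multiples of `χ`. -/
theorem exists_eq_smul_of_trace_complementProjection_nonpos [Fintype κ] {χ : n → ℂ} (hχ : χ ≠ 0)
    {v : κ → n → ℂ}
    (hperp : (complementProjection χ * ∑ k, pureState (v k)).trace.re ≤ 0)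
    (htr : (∑ k, pureState (v k)).trace = (pureState χ).trace) :
    ∃ c : κ → ℂ, (∀ k, v k = c k • χ) ∧ ∑ k, (‖c k‖ ^ 2 : ℂ) = 1 := by
  have hnonneg (k : κ) : 0 ≤ (complementProjection χ * pureState (v k)).trace := by
    rw [trace_complementProjection_mul_pureState]
    exact (posSemidef_pureState _).trace_nonneg
  have hzero : ∑ k, (complementProjection χ * pureState (v k)).trace = 0 := by
    rw [← trace_sum, ← Matrix.mul_sum]
    have hsum := Finset.sum_nonneg fun k (_ : k ∈ Finset.univ) => hnonneg k
    rw [← trace_sum, ← Matrix.mul_sum, Complex.nonneg_iff] at hsum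
    exact Complex.ext (hperp.antisymm hsum.1) hsum.2.symm
  have hv (k : κ) : v k = ((star χ ⬝ᵥ χ)⁻¹ * (star χ ⬝ᵥ v k)) • χ := by
    have hk := (Finset.sum_eq_zero_iff_of_nonneg fun k _ => hnonneg k).mp hzero k
      (Finset.mem_univ k)
    rw [trace_complementProjection_mul_pureState, trace_pureState_eq_zero_iff,
      complementProjection_mulVec] at hk
    exact sub_eq_zero.mp hk
  refine ⟨fun k => (star χ ⬝ᵥ χ)⁻¹ * (star χ ⬝ᵥ v k), hv, ?_⟩
  refine mul_right_cancel₀ (trace_pureState_eq_zero_iff.not.mpr hχ) ?_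
  calc (∑ k, (‖(star χ ⬝ᵥ χ)⁻¹ * (star χ ⬝ᵥ v k)‖ ^ 2 : ℂ)) * (pureState χ).trace
      = ∑ k, (pureState (v k)).trace := by
        rw [Finset.sum_mul]
        refine Finset.sum_congr rfl fun k _ => ?_
        conv_rhs => rw [hv k, pureState_smul, trace_smul, smul_eq_mul]
    _ = 1 * (pureState χ).trace := by rw [← trace_sum, htr, one_mul]

omit [Fintype n] [DecidableEq n] in
theorem exists_eq_smul_of_sum_pureState_eq [Finite n] [Fintype κ] {χ : n → ℂ} (hχ : χ ≠ 0)
    {v : κ → n → ℂ} (hv : ∑ k, pureState (v k) = pureState χ) :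
    ∃ c : κ → ℂ, (∀ k, v k = c k • χ) ∧ ∑ k, (‖c k‖ ^ 2 : ℂ) = 1 := by
  classical
  have := Fintype.ofFinite n
  exact exists_eq_smul_of_trace_complementProjection_nonpos hχ
    (by rw [hv, complementProjection_mul_pureState, trace_zero, Complex.zero_re]) (by rw [hv])

theorem eq_pureState_of_trace_complementProjection_nonpos {χ : n → ℂ} (hχ : χ ≠ 0)
    {M : Matrix n n ℂ} (hM : M.PosSemidef) (hperp : (complementProjection χ * M).trace.re ≤ 0)
    (htr : M.trace = (pureState χ).trace) : M = pureState χ := by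
  obtain ⟨r, v, rfl⟩ := posSemidef_iff_eq_sum_vecMulVec.mp hM
  obtain ⟨c, hv, hc⟩ := exists_eq_smul_of_trace_complementProjection_nonpos hχ hperp htr
  change ∑ k, pureState (v k) = _
  simp only [hv, pureState_smul, ← Finset.sum_smul, hc, one_smul]

end PureState

section SharedRandomness

theorem integrable_trace_mul {Λ m n 𝕜 : Type*} [RCLike 𝕜] [Fintype m] [Fintype n]
    [MeasurableSpace Λ] {μ : Measure Λ} {M : Λ → Matrix m n 𝕜}
    (hM : ∀ a b, Integrable (fun l => M l a b) μ) (Q : Matrix n m 𝕜) :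
    Integrable (fun l => (Q * M l).trace) μ := by
  simp only [trace, diag, mul_apply]
  exact integrable_finsetSum _ fun a _ => integrable_finsetSum _ fun b _ => (hM b a).const_mul _

theorem integral_trace_mul {Λ m n 𝕜 : Type*} [RCLike 𝕜] [Fintype m] [Fintype n]
    [MeasurableSpace Λ] {μ : Measure Λ} {M : Λ → Matrix m n 𝕜}
    (hM : ∀ a b, Integrable (fun l => M l a b) μ) (Q : Matrix n m 𝕜) :
    ∫ l, (Q * M l).trace ∂μ = (Q * of fun a b => ∫ l, M l a b ∂μ).trace := by
  have hterm (a b) : Integrable (fun l => Q a b * M l b a) μ := (hM b a).const_mul _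
  simp only [trace, diag, mul_apply, of_apply]
  rw [integral_finsetSum _ fun a _ => integrable_finsetSum _ fun b _ => hterm a b]
  refine Finset.sum_congr rfl fun a _ => ?_
  rw [integral_finsetSum _ fun b _ => hterm a b]
  simp only [integral_const_mul]

variable {ι n m : Type*} [Fintype ι] [DecidableEq ι] [Fintype n] [DecidableEq n] [Fintype m]
  [DecidableEq m]

theorem posSemidef_tensorMap (E : ι → QuantumChannel n m) {X : Matrix (ι → n) (ι → n) ℂ}
    (hX : X.PosSemidef) : (tensorMap (fun i => (E i).toLinearMap) X).PosSemidef := by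
  obtain ⟨K, -, hE⟩ := exists_tensorMap_eq_krausMap E
  rw [hE]
  exact posSemidef_krausMap _ hX

theorem trace_tensorMap (E : ι → QuantumChannel n m) (X : Matrix (ι → n) (ι → n) ℂ) :
    (tensorMap (fun i => (E i).toLinearMap) X).trace = X.trace := by
  obtain ⟨K, hK, hE⟩ := exists_tensorMap_eq_krausMap E
  rw [hE, trace_krausMap, sum_conjTranspose_mul_self_piKronecker hK, Matrix.one_mul]

theorem LOSRConvertible.exists_tensorMap_eq {ρ : Matrix (ι → n) (ι → n) ℂ} {χ : (ι → m) → ℂ}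
    (h : LOSRConvertible ρ (pureState χ)) (hρ : ρ.PosSemidef) (hχ : χ ≠ 0) :
    ∃ E : ι → QuantumChannel n m, tensorMap (fun i => (E i).toLinearMap) ρ = pureState χ := by
  obtain ⟨T, ⟨Λ, _, μ, _, E, hint, hT⟩, hTρ⟩ := h
  let M (l : Λ) : Matrix (ι → m) (ι → m) ℂ := tensorMap (fun i => (E l i).toLinearMap) ρ
  have hmean (Q : Matrix (ι → m) (ι → m) ℂ) :
      ∫ l, (Q * M l).trace ∂μ = (Q * pureState χ).trace := by
    rw [integral_trace_mul (hint ρ), ← hTρ]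
    exact congrArg (fun A => (Q * A).trace) (Matrix.ext fun a b => (hT ρ a b).symm)
  have htr (l : Λ) : (M l).trace = (pureState χ).trace := by
    have h1 := hmean 1
    simp only [Matrix.one_mul, M, trace_tensorMap, integral_const, probReal_univ, one_smul] at h1
    rw [← h1, trace_tensorMap]
  have hperp_int := integrable_trace_mul (hint ρ) (complementProjection χ)
  -- The component orthogonal to `χ` vanishes on average, and some `l` does no worse than average.
  obtain ⟨l, hl⟩ := exists_le_integral hperp_int.re
  refine ⟨E l, eq_pureState_of_trace_complementProjection_nonpos hχ
    (posSemidef_tensorMap (E l) hρ) (hl.trans_eq ?_) (htr l)⟩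
  rw [integral_re hperp_int, hmean, complementProjection_mul_pureState, trace_zero, map_zero]

end SharedRandomness

section LocalUnitary

variable {n m l κ γ : Type*} [Fintype n] [DecidableEq n]

theorem exists_eq_smul_of_mul_eq_smul {F : Type*} [Field F] {K : κ → Matrix n n F}
    {M G : Matrix n n F} {d : κ → F} (hKM : ∀ k, K k * M = d k • G) (hG : IsUnit G) (hd : d ≠ 0) :
    ∃ U : Matrix n n F, ∀ k, K k = d k • U := by
  obtain ⟨k₀, hk₀⟩ := Function.ne_iff.mp hd
  have hM : IsUnit M := by
    refine isUnit_of_mul_isUnit_right (x := K k₀) ?_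
    rw [hKM]
    exact hG.smul (Units.mk0 (d k₀) hk₀)
  rw [isUnit_iff_isUnit_det] at hM
  refine ⟨G * M⁻¹, fun k => ?_⟩
  rw [← Matrix.smul_mul, ← hKM, mul_nonsing_inv_cancel_right _ _ hM]

theorem exists_unitary_krausMap_eq_of_eq_smul [Fintype κ] {K : κ → Matrix n n ℂ}
    (hK : ∑ k, (K k)ᴴ * K k = 1) {d : κ → ℂ} {U : Matrix n n ℂ} (hKU : ∀ k, K k = d k • U) :
    ∃ W ∈ unitaryGroup n ℂ, ∀ X, krausMap K X = W * X * Wᴴ := by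
  let r : ℂ := (√(∑ k, ‖d k‖ ^ 2) : ℝ)
  have hr : r * star r = ∑ k, d k * star (d k) := by
    have hsq := Real.mul_self_sqrt (Finset.sum_nonneg fun k (_ : k ∈ Finset.univ) =>
      sq_nonneg ‖d k‖)
    simp only [Complex.star_def, Complex.mul_conj', r, Complex.conj_ofReal]
    exact_mod_cast hsq
  refine ⟨r • U, mem_unitaryGroup_iff'.mpr ?_, fun X => ?_⟩
  · simp only [← hK, hKU, star_eq_conjTranspose, conjTranspose_smul, Matrix.smul_mul,
      Matrix.mul_smul, smul_smul, ← Finset.sum_smul, hr]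
  · simp only [krausMap_apply, hKU, conjTranspose_smul, Matrix.smul_mul, Matrix.mul_smul, smul_smul,
      ← Finset.sum_smul, mul_comm (star _), hr]

omit [DecidableEq n] in
theorem sum_sum_mul_conjTranspose_eq_krausMap {r : Type*} [Fintype m] [DecidableEq m] [Fintype l]
    [Fintype γ] [Fintype κ] {L : γ → Matrix l m ℂ}
    (hL : ∑ g, (L g)ᴴ * L g = 1) (K : κ → Matrix r n ℂ) (Ψ : Matrix n m ℂ) :
    ∑ k, ∑ g, K k * Ψ * (L g)ᵀ * (K k * Ψ * (L g)ᵀ)ᴴ = krausMap K (Ψ * Ψᴴ) := by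
  have hLt : ∑ g, (L g)ᵀ * (L g)ᵀᴴ = 1 := by
    rw [← transpose_one, ← hL, transpose_sum]
    exact Finset.sum_congr rfl fun g _ => (transpose_mul _ _).symm
  calc ∑ k, ∑ g, K k * Ψ * (L g)ᵀ * (K k * Ψ * (L g)ᵀ)ᴴ
      = ∑ k, K k * Ψ * (∑ g, (L g)ᵀ * (L g)ᵀᴴ) * Ψᴴ * (K k)ᴴ := by
        simp only [conjTranspose_mul, Matrix.mul_sum, Matrix.sum_mul, Matrix.mul_assoc]
    _ = krausMap K (Ψ * Ψᴴ) := by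
        simp only [hLt, Matrix.mul_one, krausMap_apply, Matrix.mul_assoc]

/-- All the `K k` agree up to scalars on the columns of `Ψ * (L g)ᵀ * Bᴴ` for a fixed `g`; these
span everything because `B * Bᴴ` is invertible, so the `K k` are multiples of one matrix and act as
a single unitary. -/
theorem exists_unitary_mul_conjTranspose_eq [Fintype m] [DecidableEq m] [Fintype l] [Fintype κ]
    [Fintype γ] {K : κ → Matrix n n ℂ} {L : γ → Matrix l m ℂ} (hK : ∑ k, (K k)ᴴ * K k = 1)
    (hL : ∑ g, (L g)ᴴ * L g = 1) {Ψ : Matrix n m ℂ} {B : Matrix n l ℂ} {c : κ → γ → ℂ}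
    (hc : ∑ k, ∑ g, (‖c k g‖ ^ 2 : ℂ) = 1) (h : ∀ k g, K k * Ψ * (L g)ᵀ = c k g • B)
    (hB : IsUnit (B * Bᴴ)) :
    ∃ W ∈ unitaryGroup n ℂ, B * Bᴴ = W * (Ψ * Ψᴴ) * Wᴴ := by
  obtain ⟨g₀, hg₀⟩ : ∃ g, (fun k => c k g) ≠ 0 := by
    by_contra! hzero
    have hzero' (k g) : c k g = 0 := congrFun (hzero g) k
    simp [hzero'] at hc
  obtain ⟨U, hU⟩ := exists_eq_smul_of_mul_eq_smul (K := K) (M := Ψ * (L g₀)ᵀ * Bᴴ)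
    (fun k => by rw [← Matrix.mul_assoc, ← Matrix.mul_assoc, h, Matrix.smul_mul]) hB hg₀
  obtain ⟨W, hW, hKW⟩ := exists_unitary_krausMap_eq_of_eq_smul hK hU
  refine ⟨W, hW, ?_⟩
  rw [← hKW, ← sum_sum_mul_conjTranspose_eq_krausMap hL]
  simp only [h, conjTranspose_smul, Matrix.smul_mul, Matrix.mul_smul, smul_smul, Complex.star_def,
    Complex.conj_mul', ← Finset.sum_smul, hc, one_smul]

end LocalUnitary

section ReducedState

variable {ι n R : Type*} [DecidableEq ι]

theorem funSplitAt_symm_apply_self {ι β : Type*} [DecidableEq ι] (i : ι)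
    (p : β × ({j // j ≠ i} → β)) : (Equiv.funSplitAt i β).symm p i = p.1 := by
  simp only [Equiv.funSplitAt_symm_apply, dif_pos]

theorem funSplitAt_symm_apply_coe {ι β : Type*} [DecidableEq ι] {i : ι}
    (p : β × ({j // j ≠ i} → β)) (j : {j // j ≠ i}) :
    (Equiv.funSplitAt i β).symm p j = p.2 j := by
  simp only [Equiv.funSplitAt_symm_apply, dif_neg j.prop]

/-- A multipartite vector read as a matrix, with party `i` indexing the rows and the other parties
jointly indexing the columns. -/
def matricize (i : ι) (ψ : (ι → n) → R) : Matrix n ({j // j ≠ i} → n) R :=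
  of fun s z => ψ ((Equiv.funSplitAt i n).symm (s, z))

theorem matricize_smul [Mul R] (i : ι) (c : R) (ψ : (ι → n) → R) :
    matricize i (c • ψ) = c • matricize i ψ := rfl

variable [Fintype ι] [Fintype n]

theorem matricize_piKronecker_mulVec {m : Type*} [CommSemiring R] (i : ι)
    (A : ι → Matrix m n R) (ψ : (ι → n) → R) :
    matricize i (piKronecker A *ᵥ ψ) =
      A i * matricize i ψ * (piKronecker fun j : {j // j ≠ i} => A j)ᵀ := by
  have hsplit (s : m) (z : {j // j ≠ i} → m) (t : n) (w : {j // j ≠ i} → n) :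
      piKronecker A ((Equiv.funSplitAt i m).symm (s, z)) ((Equiv.funSplitAt i n).symm (t, w)) =
        A i s t * piKronecker (fun j : {j // j ≠ i} => A j) z w := by
    simp only [piKronecker, of_apply]
    rw [Fintype.prod_eq_mul_prod_subtype_ne _ i]
    simp only [funSplitAt_symm_apply_self, funSplitAt_symm_apply_coe]
  ext s z
  simp only [matricize, of_apply, mulVec, dotProduct]
  rw [← (Equiv.funSplitAt i n).symm.sum_comp, Fintype.sum_prod_type_right]
  simp only [hsplit, mul_apply, transpose_apply, of_apply, Finset.sum_mul]
  exact Finset.sum_congr rfl fun w _ => Finset.sum_congr rfl fun t _ => by ring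

/-- The state of party `i` when the parties share the pure state of `ψ`. -/
noncomputable def reducedState (i : ι) (ψ : (ι → n) → ℂ) : Matrix n n ℂ :=
  matricize i ψ * (matricize i ψ)ᴴ

theorem LOSRConvertible.exists_unitary_reducedState_eq [DecidableEq n]
    {ψ χ : (ι → n) → ℂ} (h : LOSRConvertible (pureState ψ) (pureState χ)) {i : ι}
    (hχ : IsUnit (reducedState i χ)) :
    ∃ W ∈ unitaryGroup n ℂ, reducedState i χ = W * reducedState i ψ * Wᴴ := by
  rcases isEmpty_or_nonempty n with hn | hn
  · exact ⟨1, one_mem _, Subsingleton.elim _ _⟩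
  have hχ0 : χ ≠ 0 := by
    rintro rfl
    have hzero : reducedState i (0 : (ι → n) → ℂ) = 0 := Matrix.zero_mul _
    exact not_isUnit_zero (hzero ▸ hχ)
  obtain ⟨E, hE⟩ := h.exists_tensorMap_eq (posSemidef_pureState ψ) hχ0
  obtain ⟨K, hK, hEK⟩ := exists_tensorMap_eq_krausMap E
  rw [hEK, krausMap_pureState] at hE
  obtain ⟨c, hc, hsum⟩ := exists_eq_smul_of_sum_pureState_eq hχ0 hE
  refine exists_unitary_mul_conjTranspose_eq (hK i)
    (sum_conjTranspose_mul_self_piKronecker fun j : {j // j ≠ i} => hK j)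
    (c := fun k g => c ((Equiv.funSplitAt i _).symm (k, g))) ?_ (fun k g => ?_) hχ
  · rw [← Fintype.sum_prod_type', ← hsum]
    exact (Equiv.funSplitAt i _).symm.sum_comp fun f => (‖c f‖ ^ 2 : ℂ)
  · rw [← matricize_smul, ← hc, matricize_piKronecker_mulVec]
    simp only [funSplitAt_symm_apply_self, funSplitAt_symm_apply_coe]

theorem LOSRConvertible.charpoly_reducedState_eq [DecidableEq n]
    {ψ χ : (ι → n) → ℂ} (h : LOSRConvertible (pureState ψ) (pureState χ)) {i : ι}
    (hχ : IsUnit (reducedState i χ)) :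
    (reducedState i χ).charpoly = (reducedState i ψ).charpoly := by
  obtain ⟨W, hW, hconj⟩ := h.exists_unitary_reducedState_eq hχ
  rw [hconj, charpoly_mul_comm, ← Matrix.mul_assoc, ← star_eq_conjTranspose,
    mem_unitaryGroup_iff'.mp hW, Matrix.one_mul]

end ReducedState

section GeneralizedGHZ

variable {ι n : Type*} [Fintype ι] [DecidableEq ι] [Fintype n] [DecidableEq n]

/-- The generalized GHZ vector `∑ₛ aₛ |s…s⟩`, in which all parties hold the same basis state. -/
def generalizedGHZ (a : n → ℂ) : (ι → n) → ℂ :=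
  ∑ s, a s • Pi.single (fun _ => s) 1

theorem matricize_generalizedGHZ_apply (i : ι) (a : n → ℂ) (s : n) (z : {j // j ≠ i} → n) :
    matricize i (generalizedGHZ a) s z = if z = fun _ => s then a s else 0 := by
  have hiff (t : n) :
      (Equiv.funSplitAt i n).symm (s, z) = (fun _ => t) ↔ s = t ∧ z = fun _ => t :=
    (Equiv.symm_apply_eq _).trans Prod.mk_inj
  simp only [matricize, generalizedGHZ, of_apply, Finset.sum_apply, Pi.smul_apply, smul_eq_mul,
    Pi.single_apply, hiff, mul_ite, mul_one, mul_zero, ite_and, Finset.sum_ite_eq,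
    Finset.mem_univ, if_true]

theorem reducedState_generalizedGHZ [Nontrivial ι] (i : ι) (a : n → ℂ) :
    reducedState i (generalizedGHZ a) = diagonal fun s => (‖a s‖ ^ 2 : ℂ) := by
  obtain ⟨j, hj⟩ := exists_ne i
  have : Nonempty {j // j ≠ i} := ⟨⟨j, hj⟩⟩
  ext s t
  have hconst : ((fun _ : {j // j ≠ i} => s) = fun _ => t) ↔ s = t := Function.const_inj
  simp only [reducedState, mul_apply, conjTranspose_apply, matricize_generalizedGHZ_apply,
    ite_mul, zero_mul, Finset.sum_ite_eq', Finset.mem_univ, if_true, diagonal_apply, hconst]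
  split_ifs with hst
  · rw [hst, Complex.star_def, Complex.mul_conj']
  · rw [star_zero, mul_zero]

theorem map_univ_eq_of_charpoly_diagonal_eq {R : Type*} [CommRing R] [IsDomain R] {a b : n → R}
    (h : (diagonal b).charpoly = (diagonal a).charpoly) :
    Finset.univ.val.map b = Finset.univ.val.map a := by
  have hroots (d : n → R) : (diagonal d).charpoly.roots = Finset.univ.val.map d := by
    rw [charpoly_diagonal]
    have := Polynomial.roots_multiset_prod_X_sub_C (Finset.univ.val.map d)
    rwa [Multiset.map_map] at this
  rw [← hroots b, h, hroots a]

theorem mainTheorem6_general [Nontrivial ι] {a b : n → ℂ} (hb : ∀ s, b s ≠ 0)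
    (h : LOSRConvertible (pureState (generalizedGHZ (ι := ι) a))
      (pureState (generalizedGHZ b))) :
    Finset.univ.val.map (fun s => ‖b s‖) = Finset.univ.val.map fun s => ‖a s‖ := by
  obtain ⟨i⟩ := Nontrivial.to_nonempty (α := ι)
  have hinv : IsUnit (reducedState i (generalizedGHZ (ι := ι) b)) := by
    rw [reducedState_generalizedGHZ, isUnit_diagonal, Pi.isUnit_iff]
    exact fun s => (pow_ne_zero 2 (Complex.ofReal_ne_zero.mpr (norm_ne_zero_iff.mpr (hb s)))).isUnit
  have hsq := h.charpoly_reducedState_eq hinv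
  rw [reducedState_generalizedGHZ, reducedState_generalizedGHZ] at hsq
  have hsqrt := congrArg (Multiset.map fun z : ℂ => √z.re)
    (map_univ_eq_of_charpoly_diagonal_eq hsq)
  simpa only [Multiset.map_map, Function.comp_def, ← Complex.ofReal_pow, Complex.ofReal_re,
    Real.sqrt_sq (norm_nonneg _)] using hsqrt

end GeneralizedGHZ

theorem ghzState_eq_pureState_generalizedGHZ (N : ℕ) (θ : ℝ) :
    ghzState N θ = pureState (generalizedGHZ fun s => (![Real.cos θ, Real.sin θ] s : ℂ)) :=
  congrArg pureState (Fin.sum_univ_two fun s : Fin 2 =>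
    (![Real.cos θ, Real.sin θ] s : ℂ) • Pi.single (fun _ => s) 1).symm

theorem cos_sin_pos_of_mem_Ioc {θ : ℝ} (hθ : θ ∈ Set.Ioc 0 (Real.pi / 4)) (s : Fin 2) :
    0 < ![Real.cos θ, Real.sin θ] s := by
  obtain ⟨hθ0, hθ1⟩ := hθ
  revert s
  exact Fin.forall_fin_two.mpr ⟨Real.cos_pos_of_mem_Ioo ⟨by linarith, by linarith⟩,
    Real.sin_pos_of_pos_of_lt_pi hθ0 (by linarith)⟩

theorem eq_of_mem_Ioc_of_cos_eq {θ φ : ℝ} (hθ : θ ∈ Set.Ioc 0 (Real.pi / 4))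
    (hφ : φ ∈ Set.Ioc 0 (Real.pi / 4))
    (h : Real.cos φ = Real.cos θ ∨ Real.cos φ = Real.sin θ) : φ = θ := by
  obtain ⟨hθ0, hθ1⟩ := hθ
  obtain ⟨hφ0, hφ1⟩ := hφ
  rcases h with h | h
  · exact Real.injOn_cos ⟨hφ0.le, by linarith⟩ ⟨hθ0.le, by linarith⟩ h
  · rw [← Real.cos_pi_div_two_sub] at h
    have := Real.injOn_cos ⟨hφ0.le, by linarith⟩ ⟨by linarith, by linarith⟩ h
    linarith

theorem eq_of_map_norm_cos_sin_eq {θ φ : ℝ} (hθ : θ ∈ Set.Ioc 0 (Real.pi / 4))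
    (hφ : φ ∈ Set.Ioc 0 (Real.pi / 4))
    (h : Finset.univ.val.map (fun s => ‖(![Real.cos φ, Real.sin φ] s : ℂ)‖) =
      Finset.univ.val.map fun s => ‖(![Real.cos θ, Real.sin θ] s : ℂ)‖) : φ = θ := by
  simp only [Complex.norm_of_nonneg (cos_sin_pos_of_mem_Ioc hθ _).le,
    Complex.norm_of_nonneg (cos_sin_pos_of_mem_Ioc hφ _).le] at h
  exact eq_of_mem_Ioc_of_cos_eq hθ hφ (by simpa using congrArg (Real.cos φ ∈ ·) h)

theorem mainTheorem6 (N : ℕ) (hN : 2 ≤ N) (θ φ : ℝ)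
    (hθ : θ ∈ Set.Ioc 0 (Real.pi / 4)) (hφ : φ ∈ Set.Ioc 0 (Real.pi / 4)) (hne : θ ≠ φ) :
    ¬ LOSRConvertible (ghzState N θ) (ghzState N φ) := by
  intro h
  have : Nontrivial (Fin N) := Fin.nontrivial_iff_two_le.mpr hN
  rw [ghzState_eq_pureState_generalizedGHZ, ghzState_eq_pureState_generalizedGHZ] at h
  exact hne (eq_of_map_norm_cos_sin_eq hθ hφ (mainTheorem6_general
    (fun s => Complex.ofReal_ne_zero.mpr (cos_sin_pos_of_mem_Ioc hφ s).ne') h)).symm
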